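/- On-line list colouring. Let $G$ be a finite graph and $f:V(G)\to\mathbb N$. In the on-line $f$-list colouring game on $G$ all vertices are initially uncoloured. In the $i$th round Alice marks a nonempty set $V_i$ of uncoloured vertices, giving each of them the permissible colour $i$, and Bob then chooses an independent set $X_i\subseteq V_i$ and colours its vertices with colour $i$. Alice wins if at some time there is an uncoloured vertex $v$ that has been marked $f(v)$ times; otherwise Bob wins. $G$ is on-line $f$-choosable if Bob has a winning strategy. Theorem. Let $G$ be a finite complete multipartite graph with independence number $m\ge 2$. Suppose that the parts of $G$ are partitioned into (possibly empty) families $\overline X_2,\dots,\overline X_m$ and $\underline X_1,\dots,\underline X_{m-1}$, where every part in $\overline X_p$ has size exactly $p$ and every part in $\underline X_p$ has size at most $p$, and each $\underline X_p=(\underline X_{p,1},\dots,\underline X_{p,\ell_p})$ is linearly ordered. Let $u_p=|\overline X_p|$, and let $|V(\underline X_p)|$ be the total number of vertices in the parts of $\underline X_p$. Let $f:V(G)\to\mathbb N$, and for $1\le j\le m$ put $$F(j)=\min\Big\{\sum_{v\in Y}f(v)\;:\;Y\subseteq X\in\bigcup_{p=2}^m\overline X_p,\ |Y|=j\Big\},\qquad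 S(j)=\sum_{p=2}^{j}u_p+\sum_{p=j+1}^m(p-j)u_p,$$ $\alpha(1)=\sum_{p=2}^m u_p$, $\beta(1)=0$, and, for $2\le j\le m$, $$\alpha(j)=\alpha(j-1)+S(j-1),\qquad \beta(j)=\beta(j-1)+\sum_{p=1}^{m-j+1}|V(\underline X_p)|.$$ Assume that (R1) $F(j)\ge\alpha(j)+\beta(j)$ for all $j=1,\dots,m$, and (R2) $f(v)\ge S(m-j)+\sum_{p=1}^{j-1}|V(\underline X_p)|+\sum_{q=1}^{i-1}|\underline X_{j,q}|+1$ for all $1\le j\le m-1$, all $1\le i\le\ell_j$ and all $v\in\underline X_{j,i}$. Then $G$ is on-line $f$-choosable. -/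

import Mathlib

namespace OnlineListColoring

variable {V : Type*} [Fintype V] [DecidableEq V]

/-! ### The on-line list colouring game

A history is the list of the sets marked by Alice so far, the most recent one at the head.
A strategy `σ` of Bob assigns to every nonempty history the set which he colours in the round
that has just been opened by Alice. Bob's earlier answers are determined by `σ` and Alice's moves,
so they need not be recorded. -/

/-- The set of vertices that are still uncoloured after the rounds recorded in the history,
if Bob plays according to `σ`. -/
def uncolored (σ : List (Finset V) → Finset V) : List (Finset V) → Finset V
  | [] => Finset.univ
  | U :: h => uncolored σ h \ σ (U :: h)

/-- In every round of the history, Alice marked a nonempty set of vertices that were uncoloured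
at that time, while Bob played according to `σ`. -/
def IsPlay (σ : List (Finset V) → Finset V) : List (Finset V) → Prop
  | [] => True
  | U :: h => IsPlay σ h ∧ U.Nonempty ∧ U ⊆ uncolored σ h

/-- The number of rounds in which `v` was marked (the number of its permissible colours). -/
def timesMarked (h : List (Finset V)) (v : V) : ℕ :=
  (h.filter (fun U => v ∈ U)).length

/-- `σ` is a winning strategy for Bob in the on-line `f`-list colouring game on `G`: however Alice
plays, Bob answers each marked set with an independent subset of it, and at no time is there an
uncoloured vertex `v` which has been marked `f v` times. (The starting position is included, so
that Alice wins if `f v = 0` for some `v`. Under this condition every play has at most `∑ v, f v`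
rounds, and since Alice can move as long as there is an uncoloured vertex, it ends with
all vertices coloured.) -/
def IsWinning (G : SimpleGraph V) (f : V → ℕ) (σ : List (Finset V) → Finset V) : Prop :=
  ∀ h : List (Finset V), IsPlay σ h →
    (∀ U h', h = U :: h' → σ h ⊆ U ∧ G.IsIndepSet (σ h : Set V)) ∧
    ∀ v ∈ uncolored σ h, timesMarked h v < f v

/-- `G` is on-line `f`-choosable: Bob has a winning strategy. -/
def OnlineChoosable (G : SimpleGraph V) (f : V → ℕ) : Prop :=
  ∃ σ : List (Finset V) → Finset V, IsWinning G f σ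

/-! ### Partitions of the parts -/

/-- `X` is a part (partite set) of the complete multipartite graph `G`, i.e. the class of some
vertex under non-adjacency. -/
def IsPart (G : SimpleGraph V) (X : Finset V) : Prop :=
  ∃ v : V, ∀ w : V, w ∈ X ↔ ¬ G.Adj v w

/-- A partition `Π` of the parts of `G` into families `upper p`, `2 ≤ p ≤ m`, of parts of size
exactly `p`, and ordered families `lower p`, `1 ≤ p ≤ m - 1`, of parts of size at most `p`.
Families may be empty. -/
structure PartPartition (G : SimpleGraph V) (m : ℕ) where
  /-- the families of parts of size exactly `p` -/
  upper : ℕ → Finset (Finset V)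
  /-- the ordered families of parts of size at most `p` -/
  lower : ℕ → List (Finset V)
  upper_eq_empty : ∀ p, p ∉ Finset.Icc 2 m → upper p = ∅
  lower_eq_nil : ∀ p, p ∉ Finset.Icc 1 (m - 1) → lower p = []
  isPart_of_mem_upper : ∀ p, ∀ X ∈ upper p, IsPart G X
  isPart_of_mem_lower : ∀ p, ∀ X ∈ lower p, IsPart G X
  card_upper : ∀ p, ∀ X ∈ upper p, X.card = p
  card_lower : ∀ p, ∀ X ∈ lower p, X.card ≤ p
  /-- every part occurs in one of the families -/
  cover : ∀ X, IsPart G X → (∃ p, X ∈ upper p) ∨ ∃ p, X ∈ lower p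
  /-- no part occurs twice in the enumeration of one `lower` family -/
  nodup_lower : ∀ p, (lower p).Nodup
  /-- different families are disjoint (for `upper` families this holds by cardinality) -/
  lower_disjoint : ∀ p q, p ≠ q → ∀ X ∈ lower p, X ∉ lower q
  upper_lower_disjoint : ∀ p q, ∀ X ∈ upper p, X ∉ lower q

namespace PartPartition

variable {G : SimpleGraph V} {m : ℕ} (P : PartPartition G m)

/-- `u_p`, the number of parts in `upper p`. -/
def u (p : ℕ) : ℕ := (P.upper p).card

/-- The number of vertices in the parts of `lower p`. -/
def numVerts (p : ℕ) : ℕ := ((P.lower p).map Finset.card).sum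

/-- `F y`, the minimum of `∑ v ∈ Y, f v` over the `y`-element subsets `Y` of parts belonging to
the `upper` families (`⊤` if there are none). -/
noncomputable def F (f : V → ℕ) (y : ℕ) : ℕ∞ :=
  ⨅ (Y : Finset V) (_ : Y.card = y ∧ ∃ p ∈ Finset.Icc 2 m, ∃ X ∈ P.upper p, Y ⊆ X),
    ((∑ v ∈ Y, f v : ℕ) : ℕ∞)

/-- `S j = ∑_{p=2}^{j} u_p + ∑_{p=j+1}^{m} (p - j) u_p`. -/
def S (j : ℕ) : ℕ :=
  ∑ p ∈ Finset.Icc 2 j, P.u p + ∑ p ∈ Finset.Icc (j + 1) m, (p - j) * P.u p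

/-- `α 1 = ∑_{p=2}^{m} u_p` and `α j = α (j - 1) + S (j - 1)` for `j ≥ 2`
(the value at `0` is not used). -/
def alpha : ℕ → ℕ
  | 0 => 0
  | 1 => ∑ p ∈ Finset.Icc 2 m, P.u p
  | j + 2 => alpha (j + 1) + P.S (j + 1)

/-- `β 1 = 0` and `β j = β (j - 1) + ∑_{p=1}^{m-j+1} |V(lower p)|` for `2 ≤ j ≤ m`
(the values at other arguments are not used). -/
def beta : ℕ → ℕ
  | 0 => 0
  | 1 => 0
  | j + 2 => beta (j + 1) + ∑ p ∈ Finset.Icc 1 (m + 1 - (j + 2)), P.numVerts p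

/-- Condition (R1). -/
def R1 (f : V → ℕ) : Prop :=
  ∀ j ∈ Finset.Icc 1 m, ((P.alpha j + P.beta j : ℕ) : ℕ∞) ≤ P.F f j

/-- Condition (R2): the lower bound on `f` on the vertices of the part at (zero-based) position
`i` of `lower j`. -/
def R2 (f : V → ℕ) : Prop :=
  ∀ j ∈ Finset.Icc 1 (m - 1), ∀ (i : ℕ) (hi : i < (P.lower j).length), ∀ v ∈ (P.lower j)[i],
    P.S (m - j) + ∑ p ∈ Finset.Icc 1 (j - 1), P.numVerts p
      + (((P.lower j).take i).map Finset.card).sum + 1 ≤ f v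

end PartPartition

end OnlineListColoring

set_option linter.unusedSectionVars false

namespace OnlineListColoring

/-! Bob keeps the game in a `Safe` position: (R1) and (R2) hold for the uncoloured vertices, with
`f` replaced by the number of colours left. Marking `U` costs a subset `Y` of an upper part `|Y ∩
U|` colours and a marked lower vertex one colour, so each answer must lower the corresponding bounds
by as much, up to available slack.

If some marked subset of an upper part attains its bound, Bob colours a largest such set `Y` and
demotes the rest of its part to lower level `m - |Y|`. Tightness of `Y` forces each remaining `v` to
carry the whole increment of `bound` from `|Y|` to `|Y| + 1`, which is what a lower vertex of that
level needs (`Safe.exists_of_tight`).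

If nothing marked is tight, every marked `Y` has a spare unit, and it suffices that `bound m j`
drops by `min (j - 1) s`, where `s` bounds the number of marked vertices in an upper part
(`Safe.bound_le_mark`). Bob achieves this by colouring a fully marked upper part if there is one;
failing that, the marked vertices of the first marked lower part if its level `l` satisfies `s ≤ m -
l`, with `s` the maximum; and otherwise the `s` marked vertices of a most marked upper part. In the
last case the remainder stays upper, unless it is a single vertex, which becomes the very first
lower vertex.

Since `Safe` gives every uncoloured vertex a positive number of colours (`Safe.pos`), Alice never
wins. -/

/-- The data describing the uncoloured part of the graph during the game: the parts in the upper
families, and the vertices in the lower families together with their family `lvl` and the position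
`key` of their part within the family. -/
structure Position (V : Type*) where
  upper : Finset (Finset V)
  lower : Finset V
  lvl : V → ℕ
  key : V → ℤ

namespace Position

variable {V : Type*}

/-- The quantity `S i` of a position. -/
def S (Q : Position V) (i : ℕ) : ℕ := ∑ X ∈ Q.upper, max 1 (X.card - i)

/-- The lower vertices whose part precedes the part of `v`. -/
def before (Q : Position V) (v : V) : Finset V :=
  Q.lower.filter fun w => Q.lvl w < Q.lvl v ∨ Q.lvl w = Q.lvl v ∧ Q.key w < Q.key v

/-- The lower vertices in the first `k` families. -/
def initial (Q : Position V) (k : ℕ) : Finset V := Q.lower.filter fun w => Q.lvl w ≤ k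

/-- The quantity `α j + β j` of a position. -/
def bound (Q : Position V) (m j : ℕ) : ℕ :=
  Q.upper.card + ∑ i ∈ Finset.range (j - 1), (Q.S (i + 1) + (Q.initial (m - (i + 1))).card)

theorem exists_key_gt (Q : Position V) : ∃ k : ℤ, ∀ v ∈ Q.lower, Q.key v < k := by
  obtain ⟨k, hk⟩ := (Q.lower.image Q.key).bddAbove
  exact ⟨k + 1, fun v hv => Int.lt_add_one_of_le (hk (by simpa using ⟨v, hv, rfl⟩))⟩

theorem exists_key_lt (Q : Position V) : ∃ k : ℤ, ∀ v ∈ Q.lower, k < Q.key v := by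
  obtain ⟨k, hk⟩ := (Q.lower.image Q.key).bddBelow
  exact ⟨k - 1, fun v hv => Int.sub_one_lt_of_le (hk (by simpa using ⟨v, hv, rfl⟩))⟩

/-! ### Arithmetic of the bounds -/

theorem sum_range_add_min_le {t t' : ℕ → ℕ} {k : ℕ}
    (h : ∀ i, t' i + (if i < k then 1 else 0) ≤ t i) (n : ℕ) :
    ∑ i ∈ Finset.range n, t' i + min n k ≤ ∑ i ∈ Finset.range n, t i := by
  induction n with
  | zero => simp
  | succ n ih =>
    rw [Finset.sum_range_succ, Finset.sum_range_succ]
    have := h n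
    split_ifs at this <;> omega

/-- For the tight case: the exceptional index is the increment at the size of the tight set, the
only one that need not drop. -/
theorem sum_range_add_le_of_ne {t t' : ℕ → ℕ} {k : ℕ}
    (h : ∀ i, t' i + (if i ≠ k then 1 else 0) ≤ t i) (n : ℕ) :
    ∑ i ∈ Finset.range n, t' i + n ≤ ∑ i ∈ Finset.range n, t i + if k < n then 1 else 0 := by
  induction n with
  | zero => simp
  | succ n ih =>
    rw [Finset.sum_range_succ, Finset.sum_range_succ]
    have := h n
    split_ifs at this ih ⊢ <;> omega

theorem bound_add_min_le {Q Q' : Position V} {m s : ℕ} (hc : Q'.upper.card ≤ Q.upper.card)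
    (h : ∀ i, Q'.S (i + 1) + (Q'.initial (m - (i + 1))).card + (if i < s then 1 else 0) ≤
      Q.S (i + 1) + (Q.initial (m - (i + 1))).card) (j : ℕ) :
    Q'.bound m j + min (j - 1) s ≤ Q.bound m j := by
  have := sum_range_add_min_le h (j - 1)
  unfold bound
  omega

variable [DecidableEq V]

/-- The uncoloured vertices. -/
def verts (Q : Position V) : Finset V := Q.upper.biUnion id ∪ Q.lower

/-- The invariant maintained by Bob. -/
structure Safe (Q : Position V) (G : SimpleGraph V) (m : ℕ) (f : V → ℕ) : Prop where
  card_le : ∀ X ∈ Q.upper, X.card ≤ m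
  indep_upper : ∀ X ∈ Q.upper, G.IsIndepSet (X : Set V)
  indep_lower : ∀ v ∈ Q.lower, ∀ w ∈ Q.lower, Q.lvl v = Q.lvl w → Q.key v = Q.key w → ¬ G.Adj v w
  disjoint_lower : ∀ X ∈ Q.upper, Disjoint X Q.lower
  disjoint_upper : ∀ X ∈ Q.upper, ∀ X' ∈ Q.upper, X ≠ X' → Disjoint X X'
  bound_le : ∀ X ∈ Q.upper, ∀ Y ⊆ X, Y.Nonempty → Q.bound m Y.card ≤ ∑ v ∈ Y, f v
  lower_le : ∀ v ∈ Q.lower, Q.S (m - Q.lvl v) + (Q.before v).card + 1 ≤ f v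

theorem mem_verts {Q : Position V} {v : V} :
    v ∈ Q.verts ↔ (∃ X ∈ Q.upper, v ∈ X) ∨ v ∈ Q.lower := by
  simp [verts]

theorem Safe.pos {Q : Position V} {G : SimpleGraph V} {m : ℕ} {f : V → ℕ} (h : Q.Safe G m f)
    {v : V} (hv : v ∈ Q.verts) : 0 < f v := by
  rcases mem_verts.1 hv with ⟨X, hX, hvX⟩ | hv
  · have h1 := h.bound_le X hX {v} (by simpa using hvX) (by simp)
    have h2 : 0 < Q.upper.card := Finset.card_pos.2 ⟨X, hX⟩
    simp only [bound, Finset.card_singleton, Finset.sum_singleton] at h1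
    omega
  · have := h.lower_le v hv
    omega

/-! ### The effect of marking -/

/-- The number of colours still available after the set `U` was marked. -/
def mark (f : V → ℕ) (U : Finset V) (v : V) : ℕ := f v - if v ∈ U then 1 else 0

theorem sum_mark (f : V → ℕ) {Y : Finset V} (U : Finset V) (h : ∀ v ∈ Y, 0 < f v) :
    ∑ v ∈ Y, mark f U v + (Y ∩ U).card = ∑ v ∈ Y, f v := by
  have : (Y ∩ U).card = ∑ v ∈ Y, if v ∈ U then 1 else 0 := by
    rw [← Finset.filter_mem_eq_inter, Finset.card_filter]
  rw [this, ← Finset.sum_add_distrib]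
  refine Finset.sum_congr rfl fun v hv => ?_
  have := h v hv
  unfold mark
  split_ifs <;> omega

theorem mark_add (f : V → ℕ) (U : Finset V) (v : V) : f v ≤ mark f U v + 1 := by
  unfold mark; split_ifs <;> omega

theorem mark_of_notMem (f : V → ℕ) {U : Finset V} {v : V} (h : v ∉ U) : mark f U v = f v := by
  simp [mark, h]

variable {Q Q' : Position V} {G : SimpleGraph V} {m : ℕ} {f : V → ℕ} {U : Finset V}

/-- If no subset of `U` is tight, then the upper condition survives the marking of `U` as soon as
the bounds decrease sufficiently. -/
theorem Safe.bound_le_mark (h : Q.Safe G m f) {s : ℕ}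
    (htight : ∀ X ∈ Q.upper, ∀ Y ⊆ X, Y.Nonempty → Y ⊆ U → Q.bound m Y.card < ∑ v ∈ Y, f v)
    (hs : ∀ X ∈ Q.upper, (X ∩ U).card ≤ s)
    (hb : ∀ j, 1 ≤ j → Q'.bound m j + min (j - 1) s ≤ Q.bound m j)
    {X : Finset V} (hX : X ∈ Q.upper) {Y : Finset V} (hY : Y ⊆ X) (hne : Y.Nonempty) :
    Q'.bound m Y.card ≤ ∑ v ∈ Y, mark f U v := by
  have h1 := sum_mark f (Y := Y) U fun v hv => h.pos (mem_verts.2 (Or.inl ⟨X, hX, hY hv⟩))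
  have h2 := hb Y.card hne.card_pos
  have h3 : (Y ∩ U).card ≤ s :=
    (Finset.card_le_card (Finset.inter_subset_inter_right hY)).trans (hs X hX)
  have h4 := hne.card_pos
  -- A fully marked `Y` loses `|Y|`, one more than the drop `|Y| - 1`; non-tightness pays the
  -- difference. Otherwise at most `min (|Y| - 1) s` is lost.
  by_cases hYU : Y ⊆ U
  · have h5 := htight X hX Y hY hne hYU
    rw [Finset.inter_eq_left.2 hYU] at h1 h3
    omega
  · have h5 := h.bound_le X hX Y hY hne
    have h6 : (Y ∩ U).card < Y.card := by
      refine Finset.card_lt_card ⟨Finset.inter_subset_left, fun h => hYU ?_⟩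
      exact h.trans Finset.inter_subset_right
    omega

/-! ### Demoting an upper part -/

/-- The position in which the upper part `X` is replaced by a lower part `R`. -/
def move (Q : Position V) (X R : Finset V) (l : ℕ) (k : ℤ) : Position V where
  upper := Q.upper.erase X
  lower := Q.lower ∪ R
  lvl v := if v ∈ R then l else Q.lvl v
  key v := if v ∈ R then k else Q.key v

theorem S_move {X R : Finset V} (hX : X ∈ Q.upper) (l : ℕ) (k : ℤ) (i : ℕ) :
    (Q.move X R l k).S i + max 1 (X.card - i) = Q.S i :=
  Finset.sum_erase_add _ _ hX

theorem card_upper_move {X R : Finset V} (hX : X ∈ Q.upper) (l : ℕ) (k : ℤ) :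
    (Q.move X R l k).upper.card + 1 = Q.upper.card :=
  Finset.card_erase_add_one hX

theorem card_initial_move_le (Q : Position V) (X R : Finset V) (l : ℕ) (k : ℤ) (i : ℕ) :
    ((Q.move X R l k).initial i).card ≤ (Q.initial i).card + if l ≤ i then R.card else 0 := by
  split_ifs with hl
  · refine (Finset.card_le_card fun w => ?_).trans (Finset.card_union_le _ _)
    simp only [initial, move, Finset.mem_filter, Finset.mem_union]
    grind
  · refine Finset.card_le_card fun w => ?_
    simp only [initial, move, Finset.mem_filter]
    grind

theorem card_before_move_le {X R : Finset V} {l : ℕ} {k : ℤ} {v : V}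
    (hv : v ∉ R) : ((Q.move X R l k).before v).card ≤
      (Q.before v).card + if l < Q.lvl v ∨ l = Q.lvl v ∧ k < Q.key v then R.card else 0 := by
  split_ifs with hl
  · refine (Finset.card_le_card fun w => ?_).trans (Finset.card_union_le _ _)
    simp only [before, move, Finset.mem_filter, Finset.mem_union]
    grind
  · refine Finset.card_le_card fun w => ?_
    simp only [before, move, Finset.mem_filter]
    grind

theorem Safe.verts_move (h : Q.Safe G m f) {X C : Finset V} (hX : X ∈ Q.upper) (hC : C ⊆ X)
    (l : ℕ) (k : ℤ) : (Q.move X (X \ C) l k).verts = Q.verts \ C := by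
  ext v
  have h1 : v ∈ X → v ∉ Q.lower := fun hv => Finset.disjoint_left.1 (h.disjoint_lower X hX) hv
  have h2 : v ∈ X → ∀ X' ∈ Q.upper, v ∈ X' → X = X' := fun hv X' hX' hv' => by
    by_contra hne
    exact Finset.disjoint_left.1 (h.disjoint_upper X hX X' hX' hne) hv hv'
  have h3 := @hC v
  simp only [mem_verts, move, Finset.mem_sdiff, Finset.mem_erase, Finset.mem_union]
  grind

/-- Moving what remains of an upper part to the lower families preserves the structural parts of
the invariant. -/
theorem Safe.move {f' : V → ℕ} (h : Q.Safe G m f) {X R : Finset V} (hX : X ∈ Q.upper) (hR : R ⊆ X)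
    {l : ℕ} {k : ℤ} (hk : ∀ v ∈ Q.lower, Q.lvl v = l → Q.key v ≠ k)
    (hb : ∀ X' ∈ Q.upper, X' ≠ X → ∀ Y ⊆ X', Y.Nonempty →
      (Q.move X R l k).bound m Y.card ≤ ∑ v ∈ Y, f' v)
    (hl : ∀ v ∈ Q.lower, (Q.move X R l k).S (m - Q.lvl v) +
      ((Q.move X R l k).before v).card + 1 ≤ f' v)
    (hn : ∀ v ∈ R, (Q.move X R l k).S (m - l) + ((Q.move X R l k).before v).card + 1 ≤ f' v) :
    (Q.move X R l k).Safe G m f' := by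
  have hdis : ∀ v ∈ Q.lower, v ∉ R := fun v hv hvR =>
    Finset.disjoint_left.1 (h.disjoint_lower X hX) (hR hvR) hv
  refine ⟨fun Y hY => h.card_le Y (Finset.mem_of_mem_erase hY),
    fun Y hY => h.indep_upper Y (Finset.mem_of_mem_erase hY), fun v hv w hw => ?_,
    fun Y hY => ?_, fun Y hY Z hZ => ?_, fun Y hY => ?_, fun v hv => ?_⟩
  · have hvw : v ∈ R → w ∈ R → ¬ G.Adj v w := fun hvR hwR hadj =>
      h.indep_upper X hX (hR hvR) (hR hwR) hadj.ne hadj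
    have := h.indep_lower v
    simp only [Position.move, Finset.mem_union] at hv hw ⊢
    grind
  · refine Finset.disjoint_union_right.2 ⟨h.disjoint_lower Y (Finset.mem_of_mem_erase hY), ?_⟩
    exact (h.disjoint_upper Y (Finset.mem_of_mem_erase hY) X hX
      (Finset.ne_of_mem_erase hY)).mono_right hR
  · exact h.disjoint_upper Y (Finset.mem_of_mem_erase hY) Z (Finset.mem_of_mem_erase hZ)
  · exact hb Y (Finset.mem_of_mem_erase hY) (Finset.ne_of_mem_erase hY)
  · by_cases hvR : v ∈ R
    · have := hn v hvR
      simpa [Position.move, hvR] using this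
    · have hv' : v ∈ Q.lower := (Finset.mem_union.1 hv).resolve_right hvR
      have := hl v hv'
      simpa [Position.move, hvR] using this

/-! ### Bob's answers -/

/-- Bob's answer if there is a tight subset of the marked set: he colours a largest one. -/
theorem Safe.exists_of_tight (h : Q.Safe G m f) {X Y : Finset V} (hX : X ∈ Q.upper) (hY : Y ⊆ X)
    (hne : Y.Nonempty) (hYU : Y ⊆ U) (ht : ∑ v ∈ Y, f v = Q.bound m Y.card)
    (hmax : ∀ X' ∈ Q.upper, ∀ Z ⊆ X', Z ⊆ U → Y.card < Z.card →
      Q.bound m Z.card < ∑ v ∈ Z, f v) :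
    ∃ Q' : Position V, Q'.verts = Q.verts \ Y ∧ Q'.Safe G m (mark f U) := by
  obtain ⟨k, hk⟩ := Q.exists_key_gt
  set r := Y.card with hr
  have hr0 : 0 < r := hne.card_pos
  have hpm := h.card_le X hX
  have hcard : (X \ Y).card + r = X.card := Finset.card_sdiff_add_card_eq_card hY
  -- Level `m - r` turns the requirement on new vertices into one about `S r`; the maximal key adds
  -- no predecessors to older vertices of that level.
  set Q' := Q.move X (X \ Y) (m - r) k with hQ'
  have hS := fun i => S_move (R := X \ Y) hX (m - r) k i
  have hU := card_upper_move (R := X \ Y) hX (m - r) k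
  rw [← hQ'] at hU
  simp only [← hQ'] at hS
  have hbd : ∀ j, 1 ≤ j → Q'.bound m j + j ≤ Q.bound m j + if r < j then 1 else 0 := by
    intro j hj
    -- The `S` term drops by `max 1 (|X| - (i + 1))`, while `|X| - r` new lower vertices are counted
    -- only when `i + 1 ≤ r`. The net drop can vanish only at `i + 1 = r`.
    have hlt : ∀ i, Q'.S (i + 1) + (Q'.initial (m - (i + 1))).card +
        (if i ≠ r - 1 then 1 else 0) ≤ Q.S (i + 1) + (Q.initial (m - (i + 1))).card := by
      intro i
      have h1 := hS (i + 1)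
      have h2 := card_initial_move_le Q X (X \ Y) (m - r) k (m - (i + 1))
      rw [← hQ'] at h2
      split_ifs at h2 ⊢ <;> omega
    have := sum_range_add_le_of_ne hlt (j - 1)
    unfold bound
    split_ifs at this ⊢ <;> omega
  refine ⟨Q', h.verts_move hX hY _ _, h.move hX Finset.sdiff_subset
    (fun v hv _ => (hk v hv).ne) ?_ ?_ ?_⟩
  · rw [← hQ']
    intro X' hX' _ Z hZ hZne
    have h1 := sum_mark f (Y := Z) U fun v hv => h.pos (mem_verts.2 (Or.inl ⟨X', hX', hZ hv⟩))
    have h2 := hbd Z.card hZne.card_pos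
    have h3 := h.bound_le X' hX' Z hZ hZne
    have h4 : (Z ∩ U).card ≤ Z.card := Finset.card_le_card Finset.inter_subset_left
    by_cases hrZ : r < Z.card
    · rw [if_pos hrZ] at h2
      by_cases hZU : Z ⊆ U
      -- `Z` is larger than `Y`, so it is not tight, which covers the missing unit.
      · have := hmax X' hX' Z hZ hZU hrZ
        omega
      · have h6 : (Z ∩ U).card < Z.card := by
          refine Finset.card_lt_card ⟨Finset.inter_subset_left, fun h => hZU ?_⟩
          exact h.trans Finset.inter_subset_right
        omega
    · rw [if_neg hrZ] at h2
      omega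
  · rw [← hQ']
    intro v hv
    have h1 := h.lower_le v hv
    have h2 := hS (m - Q.lvl v)
    have h3 : (Q'.before v).card ≤ _ := card_before_move_le (fun hvR =>
      Finset.disjoint_left.1 (h.disjoint_lower X hX) (Finset.sdiff_subset hvR) hv)
    have h4 := mark_add f U v
    have h5 := hk v hv
    split_ifs at h3 <;> omega
  · rw [← hQ']
    intro v hv
    obtain ⟨hvX, hvY⟩ := Finset.mem_sdiff.1 hv
    -- Subtracting the tight equality for `Y` from the bound for `insert v Y` isolates `f v`. If `v`
    -- is marked, `insert v Y` is not tight by maximality, which pays for the mark.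
    have hins : insert v Y ⊆ X := Finset.insert_subset hvX hY
    have hc := Finset.card_insert_of_notMem hvY
    have hsum := Finset.sum_insert (f := f) hvY
    have hle := h.bound_le X hX _ hins (Finset.insert_nonempty _ _)
    have h1 := hS r
    have h2 : (Q'.before v).card ≤ (Q.initial (m - r)).card := by
      refine Finset.card_le_card fun w => ?_
      simp only [before, initial, hQ', Position.move, Finset.mem_filter, Finset.mem_union, if_pos hv]
      have := hk w
      grind
    have h3 : Q.bound m (r + 1) = Q.bound m r + (Q.S r + (Q.initial (m - r)).card) := by
      unfold bound
      obtain ⟨q, hq⟩ : ∃ q, r = q + 1 := ⟨r - 1, by omega⟩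
      rw [hq, Nat.add_sub_cancel, Finset.sum_range_succ, Nat.add_sub_cancel, add_assoc]
    have h4 : 0 < (X \ Y).card := Finset.card_pos.2 ⟨v, hv⟩
    rw [show m - (m - r) = r by omega]
    by_cases hvU : v ∈ U
    · have h5 := mark_add f U v
      have := hmax X hX _ hins (Finset.insert_subset hvU hYU) (by omega)
      rw [hc, ← hr] at this
      omega
    · rw [mark_of_notMem f hvU]
      rw [hc, ← hr] at hle
      omega

/-- Bob's answer if he wants to colour a whole part. -/
theorem Safe.exists_of_subset (h : Q.Safe G m f)
    (htight : ∀ X ∈ Q.upper, ∀ Y ⊆ X, Y.Nonempty → Y ⊆ U → Q.bound m Y.card < ∑ v ∈ Y, f v)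
    {X : Finset V} (hX : X ∈ Q.upper) :
    ∃ Q' : Position V, Q'.verts = Q.verts \ X ∧ Q'.Safe G m (mark f U) := by
  obtain ⟨k, hk⟩ := Q.exists_key_gt
  -- The remainder is empty, so level and key are immaterial.
  set Q' := Q.move X (X \ X) 0 k with hQ'
  have hS := fun i => S_move (R := X \ X) hX 0 k i
  have hU := card_upper_move (R := X \ X) hX 0 k
  rw [← hQ'] at hU
  simp only [← hQ'] at hS
  refine ⟨Q', h.verts_move hX subset_rfl _ _, h.move hX Finset.sdiff_subset
    (fun v hv _ => (hk v hv).ne) ?_ ?_ (by simp)⟩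
  · rw [← hQ']
    intro X' hX' _ Z hZ hZne
    refine h.bound_le_mark (s := m) htight (fun X hX => (Finset.card_le_card
      Finset.inter_subset_left).trans (h.card_le X hX)) (fun j _ => ?_) hX' hZ hZne
    refine bound_add_min_le (by omega) (fun i => ?_) j
    have h1 := hS (i + 1)
    have h2 := card_initial_move_le Q X (X \ X) 0 k (m - (i + 1))
    rw [← hQ', sdiff_self, Finset.bot_eq_empty, Finset.card_empty] at h2
    split_ifs at h2 ⊢ <;> omega
  · rw [← hQ']
    intro v hv
    have h1 := h.lower_le v hv
    have h2 := hS (m - Q.lvl v)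
    have h3 : (Q'.before v).card ≤ _ := card_before_move_le (R := X \ X) (by simp)
    have h4 := mark_add f U v
    rw [sdiff_self, Finset.bot_eq_empty, Finset.card_empty] at h3
    split_ifs at h3 <;> omega

/-- Bob's answer if he colours the marked vertices of the first lower part that is hit. -/
theorem Safe.exists_of_lower (h : Q.Safe G m f)
    (htight : ∀ X ∈ Q.upper, ∀ Y ⊆ X, Y.Nonempty → Y ⊆ U → Q.bound m Y.card < ∑ v ∈ Y, f v)
    {s : ℕ} (hs : ∀ X ∈ Q.upper, (X ∩ U).card ≤ s) {v₀ : V} (hv₀ : v₀ ∈ Q.lower) (hU : v₀ ∈ U)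
    (hmin : ∀ v ∈ Q.lower, v ∈ U → Q.lvl v₀ < Q.lvl v ∨ Q.lvl v₀ = Q.lvl v ∧ Q.key v₀ ≤ Q.key v)
    (hsm : s ≤ m - Q.lvl v₀) :
    ∃ C ⊆ U, G.IsIndepSet (C : Set V) ∧
      ∃ Q' : Position V, Q'.verts = Q.verts \ C ∧ Q'.Safe G m (mark f U) := by
  set C := Q.lower.filter fun v => v ∈ U ∧ Q.lvl v = Q.lvl v₀ ∧ Q.key v = Q.key v₀ with hC
  have hCl : C ⊆ Q.lower := Finset.filter_subset _ _
  set Q' : Position V := { Q with lower := Q.lower \ C } with hQ'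
  have hv₀C : v₀ ∈ C := by simp [hC, hv₀, hU]
  have hSe : ∀ i, Q'.S i = Q.S i := fun i => rfl
  refine ⟨C, fun v hv => (Finset.mem_filter.1 hv).2.1, ?_, Q', ?_, ?_⟩
  · intro v hv w hw _
    obtain ⟨h1, -, h2, h3⟩ := Finset.mem_filter.1 hv
    obtain ⟨h1', -, h2', h3'⟩ := Finset.mem_filter.1 hw
    exact h.indep_lower v h1 w h1' (h2.trans h2'.symm) (h3.trans h3'.symm)
  · ext v
    have : ∀ X ∈ Q.upper, v ∈ X → v ∉ C := fun X hX hv hvC =>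
      Finset.disjoint_left.1 (h.disjoint_lower X hX) hv (hCl hvC)
    simp only [mem_verts, hQ', Finset.mem_sdiff]
    grind
  · refine ⟨h.card_le, h.indep_upper, fun v hv w hw => ?_, fun X hX => ?_, h.disjoint_upper,
      fun X hX Y hY hne => ?_, fun v hv => ?_⟩
    · exact h.indep_lower v (Finset.sdiff_subset hv) w (Finset.sdiff_subset hw)
    · exact (h.disjoint_lower X hX).mono_right Finset.sdiff_subset
    · refine h.bound_le_mark htight hs (fun j _ => ?_) hX hY hne
      refine bound_add_min_le (Q := Q) (Q' := Q') le_rfl (fun i => ?_) j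
      rw [hSe]
      have hsub : Q'.initial (m - (i + 1)) ⊆ Q.initial (m - (i + 1)) :=
        Finset.filter_subset_filter _ Finset.sdiff_subset
      -- For `i < s` the level of `v₀` is at most `m - (i + 1)`, so removing `v₀` is felt in this
      -- increment.
      split_ifs with hi
      · have : (Q'.initial (m - (i + 1))).card < (Q.initial (m - (i + 1))).card := by
          refine Finset.card_lt_card ⟨hsub, fun hh => ?_⟩
          have h1 : v₀ ∈ Q.initial (m - (i + 1)) :=
            Finset.mem_filter.2 ⟨hv₀, by omega⟩
          have h2 := (Finset.mem_filter.1 (hh h1)).1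
          exact (Finset.mem_sdiff.1 h2).2 hv₀C
        omega
      · have := Finset.card_le_card hsub
        omega
    · rw [hSe]
      obtain ⟨hvl, hvC⟩ := Finset.mem_sdiff.1 hv
      have h1 := h.lower_le v hvl
      have hsub : Q'.before v ⊆ Q.before v :=
        Finset.filter_subset_filter _ Finset.sdiff_subset
      change Q.S (m - Q.lvl v) + _ + 1 ≤ _
      -- A marked vertex outside `C` comes strictly after `v₀` and loses it as a predecessor.
      by_cases hvU : v ∈ U
      · have h2 := mark_add f U v
        have : (Q'.before v).card < (Q.before v).card := by
          refine Finset.card_lt_card ⟨hsub, fun hh => ?_⟩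
          have h3 := hmin v hvl hvU
          have h1 : v₀ ∈ Q.before v := by
            refine Finset.mem_filter.2 ⟨hv₀, h3.imp_right fun h4 => ⟨h4.1, h4.2.lt_of_ne ?_⟩⟩
            exact fun h5 => hvC (Finset.mem_filter.2 ⟨hvl, hvU, h4.1.symm, h5.symm⟩)
          have h2 := (Finset.mem_filter.1 (hh h1)).1
          exact (Finset.mem_sdiff.1 h2).2 hv₀C
        omega
      · rw [mark_of_notMem f hvU]
        have := Finset.card_le_card hsub
        omega

/-- Bob's answer if he colours all but one vertex of an upper part. -/
theorem Safe.exists_of_card_eq (h : Q.Safe G m f)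
    (htight : ∀ X ∈ Q.upper, ∀ Y ⊆ X, Y.Nonempty → Y ⊆ U → Q.bound m Y.card < ∑ v ∈ Y, f v)
    {X : Finset V} (hX : X ∈ Q.upper) (hs : ∀ X' ∈ Q.upper, (X' ∩ U).card ≤ (X ∩ U).card)
    (hne : (X ∩ U).Nonempty) (hcard : X.card = (X ∩ U).card + 1)
    (hlow : ∀ v ∈ Q.lower, v ∈ U → m - Q.lvl v < (X ∩ U).card) :
    ∃ Q' : Position V, Q'.verts = Q.verts \ (X ∩ U) ∧ Q'.Safe G m (mark f U) := by
  obtain ⟨k, hk⟩ := Q.exists_key_lt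
  set R := X \ (X ∩ U) with hR
  have hRc : R.card = 1 := by
    have := Finset.card_sdiff_add_card_eq_card (Finset.inter_subset_left : X ∩ U ⊆ X)
    rw [← hR] at this
    omega
  have hs0 := hne.card_pos
  set Q' := Q.move X R 0 k with hQ'
  have hS := fun i => S_move (R := R) hX 0 k i
  have hc := card_upper_move (R := R) hX 0 k
  rw [← hQ'] at hc
  simp only [← hQ'] at hS
  refine ⟨Q', h.verts_move hX Finset.inter_subset_left _ _, h.move hX Finset.sdiff_subset
    (fun v hv _ => (hk v hv).ne') ?_ ?_ ?_⟩
  · rw [← hR, ← hQ']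
    intro X' hX' _ Z hZ hZne
    refine h.bound_le_mark htight hs (fun j hj => ?_) hX' hZ hZne
    -- The leftover vertex adds one to every `initial`, so only `s - 1` increments are sure to drop;
    -- the missing unit comes from the smaller number of upper parts.
    have hlt : ∀ i, Q'.S (i + 1) + (Q'.initial (m - (i + 1))).card +
        (if i < (X ∩ U).card - 1 then 1 else 0) ≤
        Q.S (i + 1) + (Q.initial (m - (i + 1))).card := by
      intro i
      have h1 := hS (i + 1)
      have h2 := card_initial_move_le Q X R 0 k (m - (i + 1))
      rw [← hQ', hRc, if_pos (Nat.zero_le _)] at h2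
      split_ifs <;> omega
    have := sum_range_add_min_le hlt (j - 1)
    unfold bound
    omega
  · rw [← hR, ← hQ']
    intro v hv
    have h1 := h.lower_le v hv
    have h2 := hS (m - Q.lvl v)
    have h3 : (Q'.before v).card ≤ _ := card_before_move_le (fun hvR =>
      Finset.disjoint_left.1 (h.disjoint_lower X hX) (Finset.sdiff_subset hvR) hv)
    have h5 : (Q'.before v).card ≤ (Q.before v).card + 1 := by
      split_ifs at h3 <;> omega
    -- For marked `v`, `hlow` gives `|X| - (m - lvl v) ≥ 2`: the drop of `S` pays for both the mark
    -- and the new predecessor.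
    by_cases hvU : v ∈ U
    · have h4 := mark_add f U v
      have h6 := hlow v hv hvU
      omega
    · rw [mark_of_notMem f hvU]
      omega
  · rw [← hR, ← hQ']
    intro v hv
    obtain ⟨hvX, hvY⟩ := Finset.mem_sdiff.1 hv
    have hvU : v ∉ U := fun hvU => hvY (Finset.mem_inter.2 ⟨hvX, hvU⟩)
    rw [mark_of_notMem f hvU]
    have h1 := h.bound_le X hX {v} (by simpa using hvX) (by simp)
    simp only [bound, Finset.card_singleton, Finset.sum_singleton, Nat.sub_self, Finset.range_zero,
      Finset.sum_empty] at h1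
    -- Level `0` and the minimal key leave no predecessors, and `S m` just counts upper parts, so
    -- the bound for the singleton `{v}` suffices.
    have h2 : Q'.before v = ∅ := by
      refine Finset.filter_eq_empty_iff.2 fun w hw => ?_
      have := hk w
      simp only [hQ', Position.move, Finset.mem_union, if_pos hv] at hw ⊢
      grind
    have h3 : Q'.S (m - 0) = Q'.upper.card := by
      rw [Finset.card_eq_sum_ones]
      refine Finset.sum_congr rfl fun Z hZ => ?_
      have := h.card_le Z (Finset.mem_of_mem_erase hZ)
      omega
    rw [h2, h3, Finset.card_empty]
    omega

/-- Bob's answer if he colours some, but not almost all, of the vertices of an upper part. -/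
theorem Safe.exists_of_card_lt (h : Q.Safe G m f)
    (htight : ∀ X ∈ Q.upper, ∀ Y ⊆ X, Y.Nonempty → Y ⊆ U → Q.bound m Y.card < ∑ v ∈ Y, f v)
    {X : Finset V} (hX : X ∈ Q.upper) (hs : ∀ X' ∈ Q.upper, (X' ∩ U).card ≤ (X ∩ U).card)
    (hne : (X ∩ U).Nonempty) (hcard : (X ∩ U).card + 2 ≤ X.card)
    (hlow : ∀ v ∈ Q.lower, v ∈ U → m - Q.lvl v < (X ∩ U).card) :
    ∃ Q' : Position V, Q'.verts = Q.verts \ (X ∩ U) ∧ Q'.Safe G m (mark f U) := by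
  set R := X \ U with hR
  have hRX : R ⊆ X := Finset.sdiff_subset
  have hRc : R.card + (X ∩ U).card = X.card := Finset.card_sdiff_add_card_inter X U
  have hs0 := hne.card_pos
  -- `R` is nonempty and disjoint from the other upper parts, so inserting it does not collapse with
  -- one of them.
  have hRn : R ∉ Q.upper.erase X := fun hm => by
    have h1 := h.disjoint_upper X hX R (Finset.mem_of_mem_erase hm)
      (Finset.ne_of_mem_erase hm).symm
    have h2 : R = ∅ := Finset.disjoint_self_iff_empty _ |>.1 (h1.mono_left hRX)
    rw [h2, Finset.card_empty] at hRc
    omega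
  set Q' : Position V := { Q with upper := insert R (Q.upper.erase X) } with hQ'
  have hS : ∀ i, Q'.S i + max 1 (X.card - i) = Q.S i + max 1 (R.card - i) := fun i => by
    have h1 : Q'.S i = max 1 (R.card - i) + ∑ Z ∈ Q.upper.erase X, max 1 (Z.card - i) :=
      Finset.sum_insert hRn
    have h2 : ∑ Z ∈ Q.upper.erase X, max 1 (Z.card - i) + max 1 (X.card - i) = Q.S i :=
      Finset.sum_erase_add _ _ hX
    omega
  have hc : Q'.upper.card = Q.upper.card := by
    rw [hQ', Finset.card_insert_of_notMem hRn, Finset.card_erase_add_one hX]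
  have hsub : ∀ Z ∈ Q'.upper, ∃ X' ∈ Q.upper, Z ⊆ X' ∧ ((Z = R ∧ X' = X) ∨ (Z = X' ∧ X' ≠ X)) := by
    intro Z hZ
    rcases Finset.mem_insert.1 hZ with rfl | hZ
    · exact ⟨X, hX, hRX, Or.inl ⟨rfl, rfl⟩⟩
    · exact ⟨Z, Finset.mem_of_mem_erase hZ, subset_rfl, Or.inr ⟨rfl, Finset.ne_of_mem_erase hZ⟩⟩
  refine ⟨Q', ?_, fun Z hZ => ?_, fun Z hZ => ?_, h.indep_lower, fun Z hZ => ?_,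
    fun Z hZ Z' hZ' hZZ => ?_, fun Z hZ Y hY hYne => ?_, fun v hv => ?_⟩
  · ext v
    have h1 : v ∈ X → v ∉ Q.lower := fun hv => Finset.disjoint_left.1 (h.disjoint_lower X hX) hv
    have h2 : v ∈ X → ∀ X' ∈ Q.upper, v ∈ X' → X = X' := fun hv X' hX' hv' => by
      by_contra hne
      exact Finset.disjoint_left.1 (h.disjoint_upper X hX X' hX' hne) hv hv'
    simp only [mem_verts, hQ', hR, Finset.mem_sdiff, Finset.mem_erase, Finset.mem_insert,
      Finset.mem_inter, exists_eq_or_imp]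
    grind
  · obtain ⟨X', hX', hZX, -⟩ := hsub Z hZ
    exact (Finset.card_le_card hZX).trans (h.card_le X' hX')
  · obtain ⟨X', hX', hZX, -⟩ := hsub Z hZ
    exact Set.Pairwise.mono (Finset.coe_subset.2 hZX) (h.indep_upper X' hX')
  · obtain ⟨X', hX', hZX, -⟩ := hsub Z hZ
    exact (h.disjoint_lower X' hX').mono_left hZX
  · obtain ⟨X₁, hX₁, hZX₁, h1⟩ := hsub Z hZ
    obtain ⟨X₂, hX₂, hZX₂, h2⟩ := hsub Z' hZ'
    refine (h.disjoint_upper X₁ hX₁ X₂ hX₂ ?_).mono hZX₁ hZX₂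
    grind
  · obtain ⟨X', hX', hZX, -⟩ := hsub Z hZ
    refine h.bound_le_mark htight hs (fun j _ => ?_) hX' (hY.trans hZX) hYne
    refine bound_add_min_le hc.le (fun i => ?_) j
    have h1 := hS (i + 1)
    have h2 : Q'.initial (m - (i + 1)) = Q.initial (m - (i + 1)) := rfl
    rw [h2]
    -- For `i + 1 ≤ s` the old term is `|X| - (i + 1) ≥ 1` with strict inequality because `|X| ≥ s +
    -- 2`; removing `s ≥ 1` vertices therefore lowers it.
    split_ifs <;> omega
  · have h1 := h.lower_le v hv
    have h2 := hS (m - Q.lvl v)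
    have h3 : Q'.before v = Q.before v := rfl
    change Q'.S (m - Q.lvl v) + (Q'.before v).card + 1 ≤ _
    rw [h3]
    by_cases hvU : v ∈ U
    · have h4 := mark_add f U v
      have h6 := hlow v hv hvU
      omega
    · rw [mark_of_notMem f hvU]
      omega

/-- Bob can maintain the invariant during a round. -/
theorem Safe.exists_answer (h : Q.Safe G m f) (hne : U.Nonempty) (hU : U ⊆ Q.verts) :
    ∃ C ⊆ U, G.IsIndepSet (C : Set V) ∧
      ∃ Q' : Position V, Q'.verts = Q.verts \ C ∧ Q'.Safe G m (mark f U) := by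
  have hind : ∀ X ∈ Q.upper, ∀ Y ⊆ X, G.IsIndepSet (Y : Set V) := fun X hX Y hY =>
    Set.Pairwise.mono (Finset.coe_subset.2 hY) (h.indep_upper X hX)
  by_cases htight : ∀ X ∈ Q.upper, ∀ Y ⊆ X, Y.Nonempty → Y ⊆ U → Q.bound m Y.card < ∑ v ∈ Y, f v
  swap
  · set 𝒯 := U.powerset.filter fun Y => Y.Nonempty ∧ (∃ X ∈ Q.upper, Y ⊆ X) ∧
      ¬ Q.bound m Y.card < ∑ v ∈ Y, f v with h𝒯
    have hmem : ∀ Y, Y ∈ 𝒯 ↔ Y ⊆ U ∧ Y.Nonempty ∧ (∃ X ∈ Q.upper, Y ⊆ X) ∧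
      ¬ Q.bound m Y.card < ∑ v ∈ Y, f v := fun Y => by simp [h𝒯]
    have h𝒯ne : 𝒯.Nonempty := by
      push Not at htight
      obtain ⟨X, hX, Y, hY, hYne, hYU, hle⟩ := htight
      exact ⟨Y, (hmem Y).2 ⟨hYU, hYne, ⟨X, hX, hY⟩, hle.not_gt⟩⟩
    obtain ⟨Y, hY, hmax⟩ := 𝒯.exists_max_image Finset.card h𝒯ne
    obtain ⟨hYU, hYne, ⟨X, hX, hYX⟩, hle⟩ := (hmem Y).1 hY
    refine ⟨Y, hYU, hind X hX Y hYX, h.exists_of_tight hX hYX hYne hYU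
      (le_antisymm (not_lt.1 hle) (h.bound_le X hX Y hYX hYne)) fun X' hX' Z hZ hZU hlt => ?_⟩
    by_contra hcon
    exact (hmax Z ((hmem Z).2 ⟨hZU, Finset.card_pos.1 (by omega), ⟨X', hX', hZ⟩, hcon⟩)).not_gt hlt
  by_cases hfull : ∃ X ∈ Q.upper, X ⊆ U
  · obtain ⟨X, hX, hXU⟩ := hfull
    exact ⟨X, hXU, h.indep_upper X hX, h.exists_of_subset htight hX⟩
  push Not at hfull
  -- Used with the maximal `s`, and with `s = 0` when only lower vertices are marked. The
  -- lexicographically first marked vertex has the least level, so it inherits the level condition.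
  have key : ∀ s, (∀ X ∈ Q.upper, (X ∩ U).card ≤ s) →
      (∃ v ∈ Q.lower, v ∈ U ∧ s ≤ m - Q.lvl v) → ∃ C ⊆ U, G.IsIndepSet (C : Set V) ∧
      ∃ Q' : Position V, Q'.verts = Q.verts \ C ∧ Q'.Safe G m (mark f U) := by
    rintro s hs ⟨v, hv, hvU, hle⟩
    obtain ⟨v₀, hv₀, hmin⟩ := (Q.lower ∩ U).exists_min_image
      (fun w => toLex (Q.lvl w, Q.key w)) ⟨v, Finset.mem_inter.2 ⟨hv, hvU⟩⟩
    obtain ⟨hv₀l, hv₀U⟩ := Finset.mem_inter.1 hv₀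
    have hmin' : ∀ w ∈ Q.lower, w ∈ U →
        Q.lvl v₀ < Q.lvl w ∨ Q.lvl v₀ = Q.lvl w ∧ Q.key v₀ ≤ Q.key w := fun w hw hwU => by
      simpa [Prod.Lex.toLex_le_toLex] using hmin w (Finset.mem_inter.2 ⟨hw, hwU⟩)
    refine h.exists_of_lower htight hs hv₀l hv₀U hmin' ?_
    have := hmin' v hv hvU
    omega
  by_cases hup : ∃ X ∈ Q.upper, (X ∩ U).Nonempty
  · obtain ⟨X₁, hX₁, hX₁ne⟩ := hup
    obtain ⟨X, hX, hmax⟩ := Q.upper.exists_max_image (fun X => (X ∩ U).card) ⟨X₁, hX₁⟩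
    by_cases hlow : ∃ v ∈ Q.lower, v ∈ U ∧ (X ∩ U).card ≤ m - Q.lvl v
    · exact key _ hmax hlow
    push Not at hlow
    have hXne : (X ∩ U).Nonempty :=
      Finset.card_pos.1 (hX₁ne.card_pos.trans_le (hmax X₁ hX₁))
    have hlt : (X ∩ U).card < X.card := by
      refine Finset.card_lt_card ⟨Finset.inter_subset_left, fun h => hfull X hX ?_⟩
      exact h.trans Finset.inter_subset_right
    refine ⟨X ∩ U, Finset.inter_subset_right, hind X hX _ Finset.inter_subset_left, ?_⟩
    rcases Nat.lt_or_ge ((X ∩ U).card + 1) X.card with h2 | h2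
    · exact h.exists_of_card_lt htight hX hmax hXne h2 hlow
    · exact h.exists_of_card_eq htight hX hmax hXne (by omega) hlow
  · push Not at hup
    obtain ⟨v, hvU⟩ := hne
    have hv : v ∈ Q.lower := (mem_verts.1 (hU hvU)).resolve_left fun ⟨X, hX, hvX⟩ =>
      Finset.notMem_empty v (hup X hX ▸ Finset.mem_inter.2 ⟨hvX, hvU⟩)
    exact key 0 (fun X hX => by simp [hup X hX]) ⟨v, hv, hvU, Nat.zero_le _⟩

end Position

open Position

variable {V : Type*} [Fintype V] [DecidableEq V]

/-! ### From the invariant to a winning strategy -/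

open Classical in
/-- Bob's answer to the marked set `U` when `W` is the set of uncoloured vertices. -/
noncomputable def answer (G : SimpleGraph V) (m : ℕ) (W : Finset V) (f : V → ℕ) (U : Finset V) :
    Finset V :=
  if h : ∃ C ⊆ U, G.IsIndepSet (C : Set V) ∧
    ∃ Q : Position V, Q.verts = W \ C ∧ Q.Safe G m (mark f U) then h.choose else ∅

/-- The uncoloured vertices after a history to which Bob reacts with `answer`. -/
noncomputable def remaining (G : SimpleGraph V) (m : ℕ) (f : V → ℕ) :
    List (Finset V) → Finset V
  | [] => Finset.univ
  | U :: h => remaining G m f h \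
      answer G m (remaining G m f h) (fun v => f v - timesMarked h v) U

/-- The strategy of Bob that maintains the invariant. -/
noncomputable def strategy (G : SimpleGraph V) (m : ℕ) (f : V → ℕ) :
    List (Finset V) → Finset V
  | [] => ∅
  | U :: h => answer G m (remaining G m f h) (fun v => f v - timesMarked h v) U

/-- `remaining` is defined without reference to `strategy` to avoid circularity; this identifies it
with the actual uncoloured set. -/
theorem uncolored_strategy (G : SimpleGraph V) (m : ℕ) (f : V → ℕ) (h : List (Finset V)) :
    uncolored (strategy G m f) h = remaining G m f h := by
  induction h with
  | nil => rfl
  | cons U h ih => rw [uncolored, ih, remaining, strategy]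

theorem mark_timesMarked (f : V → ℕ) (U : Finset V) (h : List (Finset V)) :
    mark (fun v => f v - timesMarked h v) U = fun v => f v - timesMarked (U :: h) v := by
  funext v
  by_cases hv : v ∈ U <;> simp [mark, timesMarked, hv, Nat.sub_sub]

theorem answer_spec {G : SimpleGraph V} {m : ℕ} {Q : Position V} {f : V → ℕ} {U : Finset V}
    (hQ : Q.Safe G m f) (hne : U.Nonempty) (hU : U ⊆ Q.verts) :
    answer G m Q.verts f U ⊆ U ∧ G.IsIndepSet (answer G m Q.verts f U : Set V) ∧
      ∃ Q' : Position V, Q'.verts = Q.verts \ answer G m Q.verts f U ∧ Q'.Safe G m (mark f U) := by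
  have h := hQ.exists_answer hne hU
  rw [answer, dif_pos h]
  exact h.choose_spec

theorem exists_safe_of_isPlay {G : SimpleGraph V} {m : ℕ} {f : V → ℕ} {Q : Position V}
    (hQ : Q.Safe G m f) (hv : Q.verts = Finset.univ) {h : List (Finset V)}
    (hp : IsPlay (strategy G m f) h) :
    ∃ Q' : Position V, Q'.verts = remaining G m f h ∧
      Q'.Safe G m fun v => f v - timesMarked h v := by
  induction h with
  | nil => exact ⟨Q, hv, by simpa [timesMarked] using hQ⟩
  | cons U h ih =>
    obtain ⟨hp, hne, hU⟩ := hp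
    obtain ⟨Q', hv', hQ'⟩ := ih hp
    rw [uncolored_strategy, ← hv'] at hU
    obtain ⟨-, -, Q'', hv'', hQ''⟩ := answer_spec hQ' hne hU
    refine ⟨Q'', ?_, ?_⟩
    · rw [hv'', hv', remaining]
    · rwa [mark_timesMarked] at hQ''

theorem Position.Safe.onlineChoosable {G : SimpleGraph V} {m : ℕ} {f : V → ℕ} {Q : Position V}
    (hQ : Q.Safe G m f) (hv : Q.verts = Finset.univ) : OnlineChoosable G f := by
  refine ⟨strategy G m f, fun h hp => ⟨?_, fun v hvu => ?_⟩⟩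
  · rintro U h rfl
    obtain ⟨hp, hne, hU⟩ := hp
    obtain ⟨Q', hv', hQ'⟩ := exists_safe_of_isPlay hQ hv hp
    rw [uncolored_strategy, ← hv'] at hU
    have := answer_spec hQ' hne hU
    rw [hv'] at this
    exact ⟨this.1, this.2.1⟩
  · obtain ⟨Q', hv', hQ'⟩ := exists_safe_of_isPlay hQ hv hp
    rw [uncolored_strategy, ← hv'] at hvu
    have := hQ'.pos hvu
    omega

/-! ### The initial position -/

theorem IsPart.indepSet {G : SimpleGraph V} (hG : G.IsCompleteMultipartite) {X : Finset V}
    (hX : IsPart G X) : G.IsIndepSet (X : Set V) := by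
  obtain ⟨u, hu⟩ := hX
  intro v hv w hw _
  exact hG.trans v u w (fun h => (hu v).1 hv h.symm) ((hu w).1 hw)

theorem IsPart.subset {G : SimpleGraph V} (hG : G.IsCompleteMultipartite) {X Y : Finset V}
    (hX : IsPart G X) (hY : IsPart G Y) {v : V} (hvX : v ∈ X) (hvY : v ∈ Y) : X ⊆ Y := by
  obtain ⟨u, hu⟩ := hY
  intro w hw
  refine (hu w).2 (hG.trans u v w ((hu v).1 hvY) fun hadj => ?_)
  exact hX.indepSet hG hvX hw hadj.ne hadj

theorem IsPart.eq {G : SimpleGraph V} (hG : G.IsCompleteMultipartite) {X Y : Finset V}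
    (hX : IsPart G X) (hY : IsPart G Y) {v : V} (hvX : v ∈ X) (hvY : v ∈ Y) : X = Y :=
  (hX.subset hG hY hvX hvY).antisymm (hY.subset hG hX hvY hvX)

open Classical in
/-- The part containing `v`. -/
noncomputable def part (G : SimpleGraph V) (v : V) : Finset V := Finset.univ.filter (¬ G.Adj v ·)

theorem isPart_part (G : SimpleGraph V) (v : V) : IsPart G (part G v) := ⟨v, by simp [part]⟩

theorem mem_part (G : SimpleGraph V) (v : V) : v ∈ part G v := by simp [part]

theorem card_foldr_union_le (l : List (Finset V)) :
    (l.foldr (· ∪ ·) ∅).card ≤ (l.map Finset.card).sum := by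
  induction l with
  | nil => simp
  | cons X l ih => simpa using (Finset.card_union_le _ _).trans (Nat.add_le_add_left ih _)

theorem mem_foldr_union {l : List (Finset V)} {v : V} :
    v ∈ l.foldr (· ∪ ·) ∅ ↔ ∃ X ∈ l, v ∈ X := by
  induction l with
  | nil => simp
  | cons X l ih => simp [ih]

namespace PartPartition

variable {G : SimpleGraph V} {m : ℕ} (P : PartPartition G m)

open Classical in
/-- The position at the beginning of the game. -/
noncomputable def start : Position V where
  upper := (Finset.Icc 2 m).biUnion P.upper
  lower := Finset.univ.filter fun v => ∃ p, part G v ∈ P.lower p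
  lvl v := if h : ∃ p, part G v ∈ P.lower p then h.choose else 0
  key v := if h : ∃ p, part G v ∈ P.lower p then
    ((P.lower h.choose).idxOf (part G v) : ℤ) else 0

theorem mem_upper_start {X : Finset V} :
    X ∈ P.start.upper ↔ ∃ p ∈ Finset.Icc 2 m, X ∈ P.upper p := by
  simp [start]

theorem mem_lower_start {v : V} : v ∈ P.start.lower ↔ ∃ p, part G v ∈ P.lower p := by
  simp [start]

theorem part_mem_lower {v : V} (hv : v ∈ P.start.lower) :
    part G v ∈ P.lower (P.start.lvl v) := by
  have h := P.mem_lower_start.1 hv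
  simp only [start, dif_pos h]
  exact h.choose_spec

theorem key_start {v : V} (hv : v ∈ P.start.lower) :
    P.start.key v = (P.lower (P.start.lvl v)).idxOf (part G v) := by
  have h := P.mem_lower_start.1 hv
  simp [start, dif_pos h]

theorem lvl_mem_Icc {v : V} (hv : v ∈ P.start.lower) : P.start.lvl v ∈ Finset.Icc 1 (m - 1) := by
  by_contra h
  have := P.part_mem_lower hv
  rw [P.lower_eq_nil _ h] at this
  simp at this

theorem mem_Icc_of_mem_upper {X : Finset V} {p : ℕ} (hX : X ∈ P.upper p) :
    p ∈ Finset.Icc 2 m := by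
  by_contra h
  rw [P.upper_eq_empty _ h] at hX
  simp at hX

theorem sum_upper_start (g : ℕ → ℕ) :
    ∑ X ∈ P.start.upper, g X.card = ∑ p ∈ Finset.Icc 2 m, P.u p * g p := by
  have hd : ((Finset.Icc 2 m : Finset ℕ) : Set ℕ).PairwiseDisjoint P.upper := by
    intro p _ q _ hpq
    refine Finset.disjoint_left.2 fun X hX hX' => hpq ?_
    rw [← P.card_upper p X hX, P.card_upper q X hX']
  rw [start, Finset.sum_biUnion hd]
  refine Finset.sum_congr rfl fun p _ => ?_
  rw [Finset.sum_congr rfl fun X hX => by rw [P.card_upper p X hX], Finset.sum_const, smul_eq_mul,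
    u]

/-- Splitting the sum at `p = j` removes the maximum. `1 ≤ j` keeps the second range from reaching
below `2`. -/
theorem S_start {j : ℕ} (hj : 1 ≤ j) (hjm : j ≤ m) : P.start.S j = P.S j := by
  have hI : Finset.Icc 2 m = Finset.Icc 2 j ∪ Finset.Icc (j + 1) m := by
    ext p; simp only [Finset.mem_union, Finset.mem_Icc]; omega
  have hd : Disjoint (Finset.Icc 2 j) (Finset.Icc (j + 1) m) :=
    Finset.disjoint_left.2 fun p hp hp' => by
      simp only [Finset.mem_Icc] at hp hp'; omega
  rw [Position.S, P.sum_upper_start fun p => max 1 (p - j), hI, Finset.sum_union hd, S]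
  congr 1 <;> refine Finset.sum_congr rfl fun p hp => ?_ <;> rw [Finset.mem_Icc] at hp
  · rw [show max 1 (p - j) = 1 by omega, mul_one]
  · rw [show max 1 (p - j) = p - j by omega, mul_comm]

theorem card_upper_start : P.start.upper.card = ∑ p ∈ Finset.Icc 2 m, P.u p := by
  rw [Finset.card_eq_sum_ones, P.sum_upper_start fun _ => 1]
  simp

/-- The vertices in the first `k` lower families. -/
def lowerUnion (k : ℕ) : Finset V :=
  (Finset.Icc 1 k).biUnion fun p => (P.lower p).foldr (· ∪ ·) ∅

theorem card_lowerUnion_le (k : ℕ) :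
    (P.lowerUnion k).card ≤ ∑ p ∈ Finset.Icc 1 k, P.numVerts p :=
  Finset.card_biUnion_le.trans (Finset.sum_le_sum fun _ _ => card_foldr_union_le _)

theorem mem_lowerUnion {v : V} (hv : v ∈ P.start.lower) {k : ℕ} (hk : P.start.lvl v ≤ k) :
    v ∈ P.lowerUnion k := by
  have h := Finset.mem_Icc.1 (P.lvl_mem_Icc hv)
  exact Finset.mem_biUnion.2 ⟨_, Finset.mem_Icc.2 ⟨h.1, hk⟩,
    mem_foldr_union.2 ⟨_, P.part_mem_lower hv, mem_part G v⟩⟩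

theorem card_initial_start_le (k : ℕ) :
    (P.start.initial k).card ≤ ∑ p ∈ Finset.Icc 1 k, P.numVerts p := by
  refine (Finset.card_le_card fun v hv => ?_).trans (P.card_lowerUnion_le k)
  obtain ⟨h1, h2⟩ := Finset.mem_filter.1 hv
  exact P.mem_lowerUnion h1 h2

/-- Unrolls both recursions into the closed form used by `bound`. -/
theorem alpha_add_beta (j : ℕ) :
    P.alpha (j + 1) + P.beta (j + 1) = ∑ p ∈ Finset.Icc 2 m, P.u p +
      ∑ i ∈ Finset.range j, (P.S (i + 1) + ∑ p ∈ Finset.Icc 1 (m - (i + 1)), P.numVerts p) := by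
  induction j with
  | zero => simp [alpha, beta]
  | succ j ih =>
    rw [Finset.sum_range_succ, alpha, beta, show m + 1 - (j + 2) = m - (j + 1) by omega]
    omega

theorem bound_start_le {j : ℕ} (hj : 1 ≤ j) (hjm : j ≤ m) :
    P.start.bound m j ≤ P.alpha j + P.beta j := by
  obtain ⟨j, rfl⟩ : ∃ i, j = i + 1 := ⟨j - 1, by omega⟩
  rw [alpha_add_beta, bound, card_upper_start]
  refine Nat.add_le_add_left (Finset.sum_le_sum fun i hi => ?_) _
  rw [Finset.mem_range] at hi
  rw [P.S_start (by omega) (by omega)]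
  exact Nat.add_le_add_left (P.card_initial_start_le _) _

theorem card_before_start_le {v : V} (hv : v ∈ P.start.lower) :
    (P.start.before v).card ≤ ∑ p ∈ Finset.Icc 1 (P.start.lvl v - 1), P.numVerts p +
      (((P.lower (P.start.lvl v)).take
        ((P.lower (P.start.lvl v)).idxOf (part G v))).map Finset.card).sum := by
  set l := P.lower (P.start.lvl v) with hl
  refine (Finset.card_le_card (t := P.lowerUnion (P.start.lvl v - 1) ∪
    (l.take (l.idxOf (part G v))).foldr (· ∪ ·) ∅) fun w hw => ?_).trans
    ((Finset.card_union_le _ _).trans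
      (Nat.add_le_add (P.card_lowerUnion_le _) (card_foldr_union_le _)))
  obtain ⟨h1, h2⟩ := Finset.mem_filter.1 hw
  rcases h2 with h2 | ⟨h2, h3⟩
  · exact Finset.mem_union_left _ (P.mem_lowerUnion h1 (by omega))
  · refine Finset.mem_union_right _ (mem_foldr_union.2 ⟨part G w, ?_, mem_part G w⟩)
    have hw' := P.part_mem_lower h1
    rw [P.key_start h1, P.key_start hv, h2, ← hl, Nat.cast_lt] at h3
    rw [h2, ← hl] at hw'
    rw [List.mem_take_iff_getElem]
    exact ⟨l.idxOf (part G w), lt_min h3 (List.idxOf_lt_length_of_mem hw'), List.getElem_idxOf _⟩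

theorem verts_start : P.start.verts = Finset.univ := by
  refine Finset.eq_univ_of_forall fun v => mem_verts.2 ?_
  rcases P.cover _ (isPart_part G v) with ⟨p, hp⟩ | h
  · exact Or.inl ⟨_, P.mem_upper_start.2 ⟨p, P.mem_Icc_of_mem_upper hp, hp⟩, mem_part G v⟩
  · exact Or.inr (P.mem_lower_start.2 h)

theorem safe_start (hG : G.IsCompleteMultipartite) {f : V → ℕ} (h1 : P.R1 f) (h2 : P.R2 f) :
    P.start.Safe G m f := by
  have hpart : ∀ X ∈ P.start.upper, IsPart G X := fun X hX => by
    obtain ⟨p, _, hX⟩ := P.mem_upper_start.1 hX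
    exact P.isPart_of_mem_upper p X hX
  have hcard : ∀ X ∈ P.start.upper, X.card ≤ m := fun X hX => by
    obtain ⟨p, hp, hX⟩ := P.mem_upper_start.1 hX
    rw [P.card_upper p X hX]
    exact (Finset.mem_Icc.1 hp).2
  refine ⟨hcard, fun X hX => (hpart X hX).indepSet hG, fun v hv w hw hl hk => ?_, fun X hX => ?_,
    fun X hX X' hX' hne => ?_, fun X hX Y hY hne => ?_, fun v hv => ?_⟩
  -- Within one family, equal positions mean equal parts.
  · rw [P.key_start hv, P.key_start hw, ← hl, Nat.cast_inj,
      List.idxOf_inj (P.part_mem_lower hv)] at hk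
    have : w ∈ part G v := hk ▸ mem_part G w
    simpa [part] using this
  · refine Finset.disjoint_left.2 fun v hvX hv => ?_
    obtain ⟨p, _, hXp⟩ := P.mem_upper_start.1 hX
    obtain ⟨q, hq⟩ := P.mem_lower_start.1 hv
    rw [← (hpart X hX).eq hG (isPart_part G v) hvX (mem_part G v)] at hq
    exact P.upper_lower_disjoint p q X hXp hq
  · exact Finset.disjoint_left.2 fun v hv hv' => hne ((hpart X hX).eq hG (hpart X' hX') hv hv')
  · have hYm : Y.card ≤ m := (Finset.card_le_card hY).trans (hcard X hX)
    obtain ⟨p, hp, hXp⟩ := P.mem_upper_start.1 hX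
    have h3 := h1 Y.card (Finset.mem_Icc.2 ⟨hne.card_pos, hYm⟩)
    have h4 : P.F f Y.card ≤ ((∑ v ∈ Y, f v : ℕ) : ℕ∞) := iInf₂_le Y ⟨rfl, p, hp, X, hXp, hY⟩
    exact (P.bound_start_le hne.card_pos hYm).trans (by exact_mod_cast h3.trans h4)
  · have h3 := P.lvl_mem_Icc hv
    have h4 := P.part_mem_lower hv
    have h5 := h2 _ h3 _ (List.idxOf_lt_length_of_mem h4) v
      (by rw [List.getElem_idxOf]; exact mem_part G v)
    have h6 := P.card_before_start_le hv
    rw [Finset.mem_Icc] at h3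
    rw [P.S_start (by omega) (by omega)]
    omega

end PartPartition

end OnlineListColoring

theorem mainTheorem1 {V : Type*} [Fintype V] [DecidableEq V] (G : SimpleGraph V)
    (hG : G.IsCompleteMultipartite) (m : ℕ) (hm : 2 ≤ m) (hind : G.indepNum = m)
    (P : OnlineListColoring.PartPartition G m) (f : V → ℕ)
    (hR1 : P.R1 f) (hR2 : P.R2 f) :
    OnlineListColoring.OnlineChoosable G f :=
  (P.safe_start hG hR1 hR2).onlineChoosable P.verts_start
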